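/- **Setting.** A binary game $X$ with $n$ players consists of payoff tables $X^{(i)}\in\mathbb{R}^{2\times\cdots\times 2}$, one for each player $i$. For a tensor $p=(p_{j_1\cdots j_n})_{j\in\{1,2\}^n}$, let $M_i(p)$ be the $2\times 2$ matrix whose $k$-th row ($k=1,2$) is $$\Big(\sum_{j:\,j_i=k}p_j,\ \ \sum_{j:\,j_i=k}X^{(i)}_j\,p_j\Big).$$ The *Spohn variety* $\mathcal V_X\subseteq\mathbb P^{2^n-1}_{\mathbb R}$ is defined by $\det M_1=\cdots=\det M_n=0$. For a graph $G$ on the players, the *independence model* $\mathcal M_G\subseteq\mathbb P^{2^n-1}_{\mathbb R}$ is defined by the quadrics $p_{x_Ax_Bx_C+}\,p_{y_Ay_Bx_C+}-p_{x_Ay_Bx_C+}\,p_{y_Ax_Bx_C+}$ of all conditional independence statements $A\perp B\mid C$, where $A,B,C$ are disjoint sets of players such that $C$ separates $A$ and $B$ in $G$ (here $+$ means summation over the strategies of the remaining players). Let $\mathcal W$ be the union of the hyperplanes $\{p_{j_1\cdots j_n}=0\}$ and $\{p_{+\cdots+}=0\}$. All varieties are sets of real points, and closures are Zariski closures. Let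 $n\ge 2l$, and let $G$ be the disjoint union of $n-2l$ isolated vertices and $l$ edges. Its independence model is the Segre variety $(\mathbb P^1)^{n-2l}\times(\mathbb P^3)^l$, embedded by $$p_{j_1\cdots j_n}=\prod_{i=1}^{n-2l}\sigma^{(i)}_{j_i}\ \prod_{k=1}^{l}\sigma^{(n-2l+k)}_{j_{n-2l+2k-1}\,j_{n-2l+2k}}.$$ The *Nash conditional independence variety* of $X$ is $Y_{X,l}=\overline{(\mathcal V_X\cap\mathcal M_G)\setminus\mathcal W}$. Let $U_{X,l}\subseteq Y_{X,l}$ be the affine open part on which $\sigma^{(i)}_2\neq 0$ for $1\le i\le n-2l$ and $\sigma^{(n-2l+k)}_{22}\ne 0$ for $1\le k\le l$, regarded as a subvariety of the affine chart in which these coordinates are normalized to $1$. **Theorem.** Let $l,m\in\mathbb N$ with $l,m\geq 0$, and let $S\subseteq\mathbb R^m$ be a real affine algebraic variety, i.e. the set of common real zeros of some polynomials in $\mathbb R[x_1,\dots,x_m]$. Then there are $n\ge l$ with $n\ge 2l$ and a binary game $X$ with $n$ players such that $U_{X,l}$ is isomorphic to $S\times\mathbb R^l$ as a real affine algebraic variety,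 that is, there are mutually inverse polynomial maps between $U_{X,l}$ and $S\times\mathbb R^l$. -/

import Mathlib

open scoped LinearAlgebra.Projectivization

noncomputable section

namespace NashCI

/-! ### Real affine algebraic varieties and their isomorphisms -/

/-- A real affine algebraic variety in `ℝ^κ`: the set of common real zeros of some set of
polynomials. -/
def IsRealAffineVariety {κ : Type} (S : Set (κ → ℝ)) : Prop :=
  ∃ T : Set (MvPolynomial κ ℝ), S = {x | ∀ f ∈ T, MvPolynomial.eval x f = 0}

/-- The map `ℝ^κ → ℝ^μ` whose coordinates are the polynomials `f`. -/
def polyMap {κ μ : Type} (f : μ → MvPolynomial κ ℝ) (x : κ → ℝ) : μ → ℝ :=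
  fun i => MvPolynomial.eval x (f i)

/-- Isomorphism of real affine varieties: mutually inverse polynomial maps (equivalently, the
rings of polynomial functions are isomorphic as `ℝ`-algebras). -/
def AreIsomorphic {κ μ : Type} (A : Set (κ → ℝ)) (B : Set (μ → ℝ)) : Prop :=
  ∃ (f : μ → MvPolynomial κ ℝ) (g : κ → MvPolynomial μ ℝ),
    (∀ x ∈ A, polyMap f x ∈ B) ∧ (∀ y ∈ B, polyMap g y ∈ A) ∧
    (∀ x ∈ A, polyMap g (polyMap f x) = x) ∧ (∀ y ∈ B, polyMap f (polyMap g y) = y)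

/-- The product `S × ℝ^l` inside `ℝ^(m + l)`. -/
def prodAffineSpace {m : ℕ} (S : Set (Fin m → ℝ)) (l : ℕ) : Set (Fin m ⊕ Fin l → ℝ) :=
  {z | (fun i => z (Sum.inl i)) ∈ S}

/-- Zariski closure of a set of points of a real projective space: the points at which every
homogeneous polynomial that vanishes on the set vanishes. (Vanishing of a homogeneous polynomial
does not depend on the representative of a point.) -/
def zariskiClosure {κ : Type} (Z : Set (ℙ ℝ (κ → ℝ))) : Set (ℙ ℝ (κ → ℝ)) :=
  {P | ∀ (f : MvPolynomial κ ℝ) (d : ℕ), f.IsHomogeneous d →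
    (∀ Q ∈ Z, MvPolynomial.eval Q.rep f = 0) → MvPolynomial.eval P.rep f = 0}

/-! ### Games with binary choices, Spohn variety

The two pure strategies `1, 2` of each player are the elements `0, 1` of `Fin 2`. -/

section Game

variable {N : Type} [Fintype N] [DecidableEq N]

/-- Pure strategy profiles of the players in `N`. -/
abbrev Profile (N : Type) : Type := N → Fin 2

/-- The space of real tensors of format `2 × ⋯ × 2`, one factor for each player. -/
abbrev Tensor (N : Type) : Type := Profile N → ℝ

/-- A game with binary choices in normal form: a payoff table for each player. -/
abbrev BinaryGame (N : Type) : Type := N → Tensor N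

/-- `p_{+⋯+k+⋯+}`, with `k` in the position of player `i`. -/
def marginal (p : Tensor N) (i : N) (k : Fin 2) : ℝ :=
  ∑ j : Profile N with j i = k, p j

/-- The payoff of player `i` from the profiles in which `i` plays `k`, weighted by `p`. -/
def payoffAt (X : BinaryGame N) (p : Tensor N) (i : N) (k : Fin 2) : ℝ :=
  ∑ j : Profile N with j i = k, X i j * p j

/-- The `2 × 2` matrix of linear forms `M_i`. -/
def spohnMatrix (X : BinaryGame N) (p : Tensor N) (i : N) : Matrix (Fin 2) (Fin 2) ℝ :=
  Matrix.of fun k => ![marginal p i k, payoffAt X p i k]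

/-- The Spohn variety. -/
def spohnVariety (X : BinaryGame N) : Set (ℙ ℝ (Tensor N)) :=
  {P | ∀ i : N, (spohnMatrix X P.rep i).det = 0}

/-! ### Conditional independence models of graphs and Spohn CI varieties -/

/-- `C` separates `A` and `B` in `G`: every path from `A` to `B` meets `C`. -/
def Separates (G : SimpleGraph N) (A B C : Finset N) : Prop :=
  ∀ a ∈ A, ∀ b ∈ B, ∀ w : G.Walk a b, w.IsPath → ∃ c ∈ C, c ∈ w.support

/-- The marginal `p_{x_S +}`: sum over all profiles that agree with `x` on `S`. -/
def marginalOn (p : Tensor N) (S : Finset N) (x : Profile N) : ℝ :=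
  ∑ j : Profile N with ∀ i ∈ S, j i = x i, p j

/-- The quadrics of the statement `A ⊥ B | C` vanish at `p`:
`p_{x_A x_B x_C +} p_{y_A y_B x_C +} = p_{x_A y_B x_C +} p_{y_A x_B x_C +}`.
Here `x` and `y` range over pairs of profiles that agree on `C`, and `A.piecewise x y` is the
profile that agrees with `x` on `A` and with `y` elsewhere. -/
def CIHolds (p : Tensor N) (A B C : Finset N) : Prop :=
  ∀ x y : Profile N, (∀ i ∈ C, x i = y i) →
    marginalOn p (A ∪ B ∪ C) x * marginalOn p (A ∪ B ∪ C) y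
      - marginalOn p (A ∪ B ∪ C) (A.piecewise x y)
        * marginalOn p (A ∪ B ∪ C) (A.piecewise y x) = 0

/-- The independence model of the global Markov property of `G`. -/
def independenceModel (G : SimpleGraph N) : Set (ℙ ℝ (Tensor N)) :=
  {P | ∀ A B C : Finset N, Disjoint A B → Disjoint A C → Disjoint B C →
    Separates G A B C → CIHolds P.rep A B C}

/-- The union of the hyperplanes `p_{j_1 ⋯ j_n} = 0` and `p_{+ ⋯ +} = 0`. -/
def specialHyperplanes (N : Type) [Fintype N] [DecidableEq N] : Set (ℙ ℝ (Tensor N)) :=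
  {P | (∃ j : Profile N, P.rep j = 0) ∨ ∑ j : Profile N, P.rep j = 0}

/-- The Spohn conditional independence variety of the game `X` and the graph `G`. -/
def spohnCIVariety (X : BinaryGame N) (G : SimpleGraph N) : Set (ℙ ℝ (Tensor N)) :=
  zariskiClosure ((spohnVariety X ∩ independenceModel G) \ specialHyperplanes N)

end Game

/-! ### Nash CI varieties for isolated players and pairs -/

/-- The players: `a` isolated ones and `l` pairs, `n = a + 2 l` players in all. The members of the
pair `k` are `Sum.inr (k, 0)` and `Sum.inr (k, 1)`. -/
abbrev Player (a l : ℕ) : Type := Fin a ⊕ (Fin l × Fin 2)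

/-- The clique to which a player belongs. -/
def clique {a l : ℕ} : Player a l → Fin a ⊕ Fin l := Sum.map id Prod.fst

/-- The disjoint union of `a` cliques with one vertex and `l` cliques with two vertices. -/
def nashGraph (a l : ℕ) : SimpleGraph (Player a l) where
  Adj i j := i ≠ j ∧ clique i = clique j
  symm := ⟨fun _ _ h => ⟨h.1.symm, h.2.symm⟩⟩
  loopless := ⟨fun _ h => h.1 rfl⟩

/-- The Nash CI variety `Y_{X,l}`. -/
def nashCIVariety {a l : ℕ} (X : BinaryGame (Player a l)) : Set (ℙ ℝ (Tensor (Player a l))) :=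
  spohnCIVariety X (nashGraph a l)

/-- Index set of the coordinates of the factors of `(ℙ¹)^a × (ℙ³)^l`: `Sum.inl (i, j)` stands for
`σ^(i)_j` and `Sum.inr (k, j₁, j₂)` for `σ^(a+k)_{j₁ j₂}`. -/
abbrev SegreIndex (a l : ℕ) : Type := (Fin a × Fin 2) ⊕ (Fin l × Fin 2 × Fin 2)

/-- The Segre parametrization: each entry of the tensor is the product of the corresponding
coordinates of all factors. -/
def segre {a l : ℕ} (σ : SegreIndex a l → ℝ) : Tensor (Player a l) :=
  fun j => (∏ i : Fin a, σ (Sum.inl (i, j (Sum.inl i)))) *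
    ∏ k : Fin l, σ (Sum.inr (k, j (Sum.inr (k, 0)), j (Sum.inr (k, 1))))

/-- The affine open part `U_{X,l}` of `Y_{X,l}` on which the coordinates `σ^(i)_2` of the `ℙ¹`
factors and `σ^(a+k)_{22}` of the `ℙ³` factors do not vanish, in the affine coordinates of this
chart: these coordinates are normalized to `1`. -/
def affinePart {a l : ℕ} (X : BinaryGame (Player a l)) : Set (SegreIndex a l → ℝ) :=
  {σ | (∀ i, σ (Sum.inl (i, 1)) = 1) ∧ (∀ k, σ (Sum.inr (k, 1, 1)) = 1) ∧
    ∃ h : segre σ ≠ 0, Projectivization.mk ℝ (segre σ) h ∈ nashCIVariety X}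

end NashCI

end

noncomputable section

namespace NashCI

/-! Give pair members zero payoffs, and pay an isolated player only for the second strategy. The
determinants of pair members vanish, and that of an isolated player `i` is `p_{+⋯1⋯+}` times a
linear form, the incentive of `i`. On the model and off the special hyperplanes the first factor is
nonzero (`marginal_ne_zero`), so the incentive vanishes there and on the closure. Conversely, a
Segre point with positive coordinates and zero incentives lies off those hyperplanes, so it is in
the variety. If all normalized solutions are positive, the affine part is thus exactly the solution
set of the incentive equations (`mem_affinePart_incentiveGame`).

On the chart, an incentive can be any combination of squarefree monomials in the coordinates of
other isolated players, or of single pair coordinates. Higher powers are obtained from several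
players carrying copies of one variable, with incentives forcing the copies to agree. This realizes
the zero set of any polynomial with positive zeros and normalized pair coordinates
(`exists_affinePart_iso_zeroSet`).

Sums of squares reduce any real variety to one equation. The numbers `s ^ 2 + 1` and `(s + 1) ^ 2 +
1` are positive and determine `s` polynomially, so every real zero set is isomorphic to one with
positive coordinates (`positiveModel`). The factor `ℝ^l` is encoded in this way too; all pair
coordinates are fixed at `1`. -/

/-- Over the reals, finitely many equations can be replaced by a single one. -/
theorem IsRealAffineVariety.exists_eq_zeroSet {κ : Type} [Finite κ] {S : Set (κ → ℝ)}
    (hS : IsRealAffineVariety S) :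
    ∃ F : MvPolynomial κ ℝ, S = {x | MvPolynomial.eval x F = 0} := by
  obtain ⟨T, rfl⟩ := hS
  obtain ⟨s, hsT, hs⟩ := Submodule.fg_span_iff_fg_span_finset_subset T |>.1
    (IsNoetherian.noetherian (Submodule.span (MvPolynomial κ ℝ) T))
  refine ⟨∑ f ∈ s, f ^ 2, ?_⟩
  ext x
  simp only [Set.mem_ofPred_eq, map_sum, map_pow]
  constructor
  · intro h
    exact Finset.sum_eq_zero fun f hf => by rw [h f (hsT hf)]; ring
  · intro h f hf
    rw [Finset.sum_eq_zero_iff_of_nonneg fun _ _ => sq_nonneg _] at h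
    have hle : Submodule.span (MvPolynomial κ ℝ) (s : Set (MvPolynomial κ ℝ)) ≤
        RingHom.ker (MvPolynomial.eval x) :=
      Submodule.span_le.2 fun g hg => by
        simpa using h g hg
    have hf' := Submodule.subset_span (R := MvPolynomial κ ℝ) hf
    rw [hs] at hf'
    exact hle hf'

/-! ### Composition of polynomial isomorphisms. -/

theorem polyMap_bind₁ {κ μ ν : Type} (f : μ → MvPolynomial κ ℝ) (g : ν → MvPolynomial μ ℝ)
    (x : κ → ℝ) : polyMap (fun i => MvPolynomial.bind₁ f (g i)) x = polyMap g (polyMap f x) := by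
  funext i
  simp only [polyMap, MvPolynomial.eval, MvPolynomial.eval₂Hom_bind₁]
  rfl

theorem AreIsomorphic.trans {κ μ ν : Type} {A : Set (κ → ℝ)} {B : Set (μ → ℝ)} {C : Set (ν → ℝ)}
    (h₁ : AreIsomorphic A B) (h₂ : AreIsomorphic B C) : AreIsomorphic A C := by
  obtain ⟨f, g, hf, hg, hgf, hfg⟩ := h₁
  obtain ⟨f', g', hf', hg', hgf', hfg'⟩ := h₂
  refine ⟨fun i => MvPolynomial.bind₁ f (f' i), fun i => MvPolynomial.bind₁ g' (g i), ?_, ?_, ?_, ?_⟩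
  · intro x hx
    rw [polyMap_bind₁]
    exact hf' _ (hf x hx)
  · intro y hy
    rw [polyMap_bind₁]
    exact hg _ (hg' y hy)
  · intro x hx
    rw [polyMap_bind₁, polyMap_bind₁, hgf' _ (hf x hx), hgf x hx]
  · intro y hy
    rw [polyMap_bind₁, polyMap_bind₁, hfg _ (hg' y hy), hfg' y hy]

/-! ### Conditional independence -/

theorem separates_singleton_compl {a l : ℕ} (i : Fin a) :
    Separates (nashGraph a l) {Sum.inl i} {Sum.inl i}ᶜ ∅ := by
  intro x hx y hy w _
  rw [Finset.mem_singleton] at hx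
  subst hx
  cases w with
  | nil => simp at hy
  | @cons _ v _ h _ =>
    exfalso
    obtain ⟨h₁, h₂⟩ := h
    rcases v with v | v
    · simp only [clique, Sum.map_inl, id, Sum.inl.injEq] at h₂
      exact h₁ (congrArg Sum.inl h₂)
    · simp [clique] at h₂

/-- Independence of `i` from all other players makes the two slices of `p` proportional, with
nonzero ratio. If one marginal vanished, so would the other, and hence the total sum. -/
theorem marginal_ne_zero {a l : ℕ} {p : Tensor (Player a l)} (i : Fin a)
    (hCI : CIHolds p {Sum.inl i} {Sum.inl i}ᶜ ∅) (hp : ∀ j, p j ≠ 0) (hsum : ∑ j, p j ≠ 0) :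
    marginal p (Sum.inl i) 0 ≠ 0 := by
  intro h0
  apply hsum
  have hmarg : ∀ x, marginalOn p ({Sum.inl i} ∪ {Sum.inl i}ᶜ ∪ ∅) x = p x := by
    intro x
    rw [marginalOn, Finset.union_empty, Finset.union_compl, Finset.sum_eq_single_of_mem x]
    · simp
    · intro j hj hjx
      exact absurd (funext fun t => (Finset.mem_filter.1 hj).2 t (Finset.mem_univ t)) hjx
  set x : Profile (Player a l) := fun _ => 1 with hx
  set x' : Profile (Player a l) := Function.update x (Sum.inl i) 0 with hx'
  have key : ∀ y : Profile (Player a l), y (Sum.inl i) = 0 →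
      p x * p y = p x' * p (Function.update y (Sum.inl i) 1) := by
    intro y hy
    have h := hCI x y (by simp)
    rw [hmarg, hmarg, hmarg, hmarg] at h
    have e1 : ({Sum.inl i} : Finset (Player a l)).piecewise x y
        = Function.update y (Sum.inl i) 1 := by
      rw [Finset.piecewise_singleton]
    have e2 : ({Sum.inl i} : Finset (Player a l)).piecewise y x = x' := by
      rw [Finset.piecewise_singleton, hy]
    rw [e1, e2] at h
    linarith
  have hrel : p x * marginal p (Sum.inl i) 0 = p x' * marginal p (Sum.inl i) 1 := by
    rw [marginal, marginal, Finset.mul_sum, Finset.mul_sum]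
    refine Finset.sum_nbij' (fun y => Function.update y (Sum.inl i) 1)
      (fun y => Function.update y (Sum.inl i) 0) ?_ ?_ ?_ ?_ ?_
    · simp
    · simp
    · intro y hy
      simp only [Finset.mem_filter, Finset.mem_univ, true_and] at hy
      simp [← hy]
    · intro y hy
      simp only [Finset.mem_filter, Finset.mem_univ, true_and] at hy
      simp [← hy]
    · intro y hy
      simp only [Finset.mem_filter, Finset.mem_univ, true_and] at hy
      exact key y hy
  have h1 : marginal p (Sum.inl i) 1 = 0 := by
    rw [h0, mul_zero] at hrel
    exact (mul_eq_zero.1 hrel.symm).resolve_left (hp x')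
  have : ∑ j, p j = marginal p (Sum.inl i) 0 + marginal p (Sum.inl i) 1 := by
    rw [marginal, marginal, ← Finset.sum_filter_add_sum_filter_not _
      (fun j : Profile (Player a l) => j (Sum.inl i) = 0)]
    congr 2
    ext j
    simp only [Finset.mem_filter, Finset.mem_univ, true_and]
    lia
  rw [this, h0, h1, add_zero]

/-- A Segre tensor is a product over cliques, so exchanging whole clique blocks between two profiles
only permutes factors. -/
theorem segre_piecewise_mul {a l : ℕ} (σ : SegreIndex a l → ℝ) (R : Finset (Fin a ⊕ Fin l))
    (j j' : Profile (Player a l)) :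
    segre σ (fun i => if clique i ∈ R then j i else j' i) *
      segre σ (fun i => if clique i ∈ R then j' i else j i) = segre σ j * segre σ j' := by
  have h₁ : ∀ A B C D A' B' C' D' : ℝ, A * C = A' * C' → B * D = B' * D' →
      (A * B) * (C * D) = (A' * B') * (C' * D') := by
    intro A B C D A' B' C' D' h h'
    linear_combination (B * D) * h + (A' * C') * h'
  simp only [segre]
  apply h₁
  · rw [← Finset.prod_mul_distrib, ← Finset.prod_mul_distrib]
    refine Finset.prod_congr rfl fun i _ => ?_
    by_cases hi : (Sum.inl i : Fin a ⊕ Fin l) ∈ R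
    · simp [clique, hi]
    · simp [clique, hi, mul_comm]
  · rw [← Finset.prod_mul_distrib, ← Finset.prod_mul_distrib]
    refine Finset.prod_congr rfl fun i _ => ?_
    by_cases hi : (Sum.inr i : Fin a ⊕ Fin l) ∈ R
    · simp [clique, hi]
    · simp [clique, hi, mul_comm]

/-- Two distinct players of one clique are joined by an edge, a path that avoids `C`. -/
theorem not_separates_of_clique_eq {a l : ℕ} {A B C : Finset (Player a l)} (hAB : Disjoint A B)
    (hAC : Disjoint A C) (hBC : Disjoint B C) (h : Separates (nashGraph a l) A B C)
    {x y : Player a l} (hx : x ∈ A) (hy : y ∈ B) : clique x ≠ clique y := by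
  intro hxy
  have hne : x ≠ y := fun e => Finset.disjoint_left.1 hAB hx (e ▸ hy)
  have hadj : (nashGraph a l).Adj x y := ⟨hne, hxy⟩
  obtain ⟨c, hc, hcs⟩ := h x hx y hy hadj.toWalk (by
    simp [SimpleGraph.Walk.isPath_def, hne])
  simp only [SimpleGraph.Walk.support_cons, SimpleGraph.Walk.support_nil, List.mem_cons,
    List.not_mem_nil, or_false] at hcs
  rcases hcs with rfl | rfl
  · exact Finset.disjoint_left.1 hAC hx hc
  · exact Finset.disjoint_left.1 hBC hy hc

theorem cIHolds_segre {a l : ℕ} (σ : SegreIndex a l → ℝ) {A B C : Finset (Player a l)}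
    (hAB : Disjoint A B) (hAC : Disjoint A C) (hBC : Disjoint B C)
    (h : Separates (nashGraph a l) A B C) : CIHolds (segre σ) A B C := by
  intro x y hxy
  -- Exchanging the blocks of all cliques that meet `A` moves `A` and fixes `B`. Where it moves part
  -- of `C`, nothing changes, as `x` and `y` agree there. The exchange is an involution matching the
  -- terms of the two products of marginals.
  set R : Finset (Fin a ⊕ Fin l) := A.image clique with hR
  have hA : ∀ i ∈ A, clique i ∈ R := fun i hi => Finset.mem_image_of_mem _ hi
  have hB : ∀ i ∈ B, clique i ∉ R := by
    intro i hi hiR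
    obtain ⟨k, hk, hki⟩ := Finset.mem_image.1 hiR
    exact not_separates_of_clique_eq hAB hAC hBC h hk hi hki
  have hpw : ∀ u v : Profile (Player a l), (∀ i ∈ C, u i = v i) → ∀ i ∈ A ∪ B ∪ C,
      A.piecewise u v i = if clique i ∈ R then u i else v i := by
    intro u v huv i hi
    simp only [Finset.mem_union] at hi
    rcases hi with (hi | hi) | hi
    · simp [hi, hA i hi]
    · simp [Finset.disjoint_right.1 hAB hi, hB i hi]
    · simp [Finset.disjoint_right.1 hAC hi, huv i hi]
  rw [sub_eq_zero]
  simp only [marginalOn]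
  rw [Finset.sum_mul_sum, Finset.sum_mul_sum, ← Finset.sum_product', ← Finset.sum_product']
  let swap : Profile (Player a l) × Profile (Player a l) →
      Profile (Player a l) × Profile (Player a l) := fun q =>
    (fun i => if clique i ∈ R then q.1 i else q.2 i, fun i => if clique i ∈ R then q.2 i else q.1 i)
  have hswap : ∀ q, swap (swap q) = q := by
    intro q
    refine Prod.ext (funext fun i => ?_) (funext fun i => ?_) <;>
    · simp only [swap]
      split_ifs <;> rfl
  refine Finset.sum_nbij' swap swap ?_ ?_ (fun q _ => hswap q) (fun q _ => hswap q) ?_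
  · rintro ⟨j, j'⟩ hq
    simp only [Finset.mem_product, Finset.mem_filter, Finset.mem_univ, true_and] at hq ⊢
    refine ⟨fun i hi => ?_, fun i hi => ?_⟩
    · rw [hpw x y hxy i hi]
      simp only [swap, hq.1 i hi, hq.2 i hi]
    · rw [hpw y x (fun i hi => (hxy i hi).symm) i hi]
      simp only [swap, hq.1 i hi, hq.2 i hi]
  · rintro ⟨j, j'⟩ hq
    simp only [Finset.mem_product, Finset.mem_filter, Finset.mem_univ, true_and] at hq ⊢
    refine ⟨fun i hi => ?_, fun i hi => ?_⟩
    · simp only [swap, hq.1 i hi, hq.2 i hi, hpw x y hxy i hi,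
        hpw y x (fun i hi => (hxy i hi).symm) i hi]
      split_ifs <;> rfl
    · simp only [swap, hq.1 i hi, hq.2 i hi, hpw x y hxy i hi,
        hpw y x (fun i hi => (hxy i hi).symm) i hi]
      split_ifs <;> rfl
  · rintro ⟨j, j'⟩ _
    exact (segre_piecewise_mul σ R j j').symm

theorem CIHolds.smul {N : Type} [Fintype N] [DecidableEq N] {p : Tensor N} {A B C : Finset N}
    (h : CIHolds p A B C) (c : ℝ) : CIHolds (c • p) A B C := by
  have hm : ∀ S x, marginalOn (c • p) S x = c * marginalOn p S x := fun S x => by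
    simp [marginalOn, Finset.mul_sum]
  intro x y hxy
  rw [hm, hm, hm, hm]
  linear_combination c ^ 2 * h x y hxy

/-! ### Games with prescribed equations -/

/-- The linear form `∑ D_j p_j` over the profiles in which the isolated player `i` plays the second
strategy. -/
def incentive {a l : ℕ} (D : Fin a → Tensor (Player a l)) (i : Fin a) (p : Tensor (Player a l)) :
    ℝ :=
  ∑ j : Profile (Player a l) with j (Sum.inl i) = 1, D i j * p j

/-- The game in which the members of pairs are indifferent and each isolated player `i` gets `D i`
if he plays the second strategy, and nothing otherwise. -/
def incentiveGame {a l : ℕ} (D : Fin a → Tensor (Player a l)) : BinaryGame (Player a l) :=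
  Sum.elim (fun i j => if j (Sum.inl i) = 1 then D i j else 0) (fun _ _ => 0)

theorem incentive_smul {a l : ℕ} (D : Fin a → Tensor (Player a l)) (i : Fin a)
    (p : Tensor (Player a l)) (c : ℝ) : incentive D i (c • p) = c * incentive D i p := by
  simp only [incentive, Finset.mul_sum, Pi.smul_apply, smul_eq_mul]
  exact Finset.sum_congr rfl fun j _ => by ring

theorem det_spohnMatrix_inl {a l : ℕ} (D : Fin a → Tensor (Player a l)) (p : Tensor (Player a l))
    (i : Fin a) : (spohnMatrix (incentiveGame D) p (Sum.inl i)).det =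
      marginal p (Sum.inl i) 0 * incentive D i p := by
  have h0 : payoffAt (incentiveGame D) p (Sum.inl i) 0 = 0 := by
    refine Finset.sum_eq_zero fun j hj => ?_
    simp [incentiveGame, (Finset.mem_filter.1 hj).2]
  have h1 : payoffAt (incentiveGame D) p (Sum.inl i) 1 = incentive D i p := by
    refine Finset.sum_congr rfl fun j hj => ?_
    simp [incentiveGame, (Finset.mem_filter.1 hj).2]
  simp [Matrix.det_fin_two, spohnMatrix, h0, h1]

theorem det_spohnMatrix_inr {a l : ℕ} (D : Fin a → Tensor (Player a l)) (p : Tensor (Player a l))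
    (i : Fin l × Fin 2) : (spohnMatrix (incentiveGame D) p (Sum.inr i)).det = 0 := by
  have h : ∀ k, payoffAt (incentiveGame D) p (Sum.inr i) k = 0 := fun k =>
    Finset.sum_eq_zero fun j hj => by simp [incentiveGame]
  simp [Matrix.det_fin_two, spohnMatrix, h]

/-- The points of the chart in which the last coordinate of each factor is `1`. -/
def IsNormalized {a l : ℕ} (σ : SegreIndex a l → ℝ) : Prop :=
  (∀ i, σ (Sum.inl (i, 1)) = 1) ∧ ∀ k, σ (Sum.inr (k, 1, 1)) = 1

theorem segre_ne_zero {a l : ℕ} {σ : SegreIndex a l → ℝ} (hσ : IsNormalized σ) : segre σ ≠ 0 := by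
  intro h
  have := congrFun h fun _ => 1
  simp [segre, hσ.1, hσ.2] at this

theorem exists_rep_mk {κ : Type} (p : κ → ℝ) (hp : p ≠ 0) :
    ∃ c : ℝ, c ≠ 0 ∧ (Projectivization.mk ℝ p hp).rep = c • p := by
  obtain ⟨c, hc⟩ := Projectivization.exists_smul_eq_mk_rep ℝ p hp
  exact ⟨c, c.ne_zero, hc.symm⟩

/-- The incentive is a linear form, so its vanishing off the special hyperplanes passes to the
Zariski closure. -/
theorem incentive_eq_zero_of_mem {a l : ℕ} {D : Fin a → Tensor (Player a l)}
    {P : ℙ ℝ (Tensor (Player a l))} (hP : P ∈ nashCIVariety (incentiveGame D)) (i : Fin a) :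
    incentive D i P.rep = 0 := by
  have heval : ∀ p : Tensor (Player a l), MvPolynomial.eval p
      (∑ j : Profile (Player a l) with j (Sum.inl i) = 1,
        MvPolynomial.C (D i j) * MvPolynomial.X j) = incentive D i p := fun p => by
    simp [incentive]
  rw [← heval]
  refine hP _ 1 ?_ ?_
  · refine MvPolynomial.IsHomogeneous.sum _ _ _ fun j _ => ?_
    simpa using (MvPolynomial.isHomogeneous_C _ (D i j)).mul (MvPolynomial.isHomogeneous_X ℝ j)
  · rintro Q ⟨⟨hV, hM⟩, hW⟩
    rw [heval]
    have hdet := hV (Sum.inl i)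
    rw [det_spohnMatrix_inl] at hdet
    simp only [specialHyperplanes, Set.mem_ofPred_eq, not_or, not_exists] at hW
    refine (mul_eq_zero.1 hdet).resolve_left (marginal_ne_zero i ?_ hW.1 hW.2)
    exact hM _ _ _ disjoint_compl_right (Finset.disjoint_empty_right _)
      (Finset.disjoint_empty_right _) (separates_singleton_compl i)

theorem mk_segre_mem {a l : ℕ} {D : Fin a → Tensor (Player a l)} {σ : SegreIndex a l → ℝ}
    (hσ : segre σ ≠ 0) (hD : ∀ i, incentive D i (segre σ) = 0) (hpos : ∀ s, 0 < σ s) :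
    Projectivization.mk ℝ (segre σ) hσ ∈ nashCIVariety (incentiveGame D) := by
  intro f d _ hf
  apply hf
  obtain ⟨c, hc, hrep⟩ := exists_rep_mk (segre σ) hσ
  have hp : ∀ j, 0 < segre σ j := fun j =>
    mul_pos (Finset.prod_pos fun _ _ => hpos _) (Finset.prod_pos fun _ _ => hpos _)
  refine ⟨⟨?_, ?_⟩, ?_⟩
  · rintro (i | i)
    · rw [det_spohnMatrix_inl, hrep, incentive_smul, hD, mul_zero, mul_zero]
    · exact det_spohnMatrix_inr _ _ _
  · intro A B C hAB hAC hBC h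
    rw [hrep]
    exact (cIHolds_segre σ hAB hAC hBC h).smul c
  · simp only [specialHyperplanes, Set.mem_ofPred_eq, hrep, Pi.smul_apply, smul_eq_mul,
      ← Finset.mul_sum, mul_eq_zero, hc, false_or, not_or, not_exists]
    exact ⟨fun j => (hp j).ne', (Finset.sum_pos (fun j _ => hp j) Finset.univ_nonempty).ne'⟩

/-- Positivity ensures that the closure neither adds nor loses solutions in the chart. -/
theorem mem_affinePart_incentiveGame {a l : ℕ} {D : Fin a → Tensor (Player a l)}
    (hpos : ∀ σ, IsNormalized σ → (∀ i, incentive D i (segre σ) = 0) → ∀ s, 0 < σ s)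
    (σ : SegreIndex a l → ℝ) :
    σ ∈ affinePart (incentiveGame D) ↔
      IsNormalized σ ∧ ∀ i, incentive D i (segre σ) = 0 := by
  constructor
  · rintro ⟨h₁, h₂, hσ, hmem⟩
    refine ⟨⟨h₁, h₂⟩, fun i => ?_⟩
    obtain ⟨c, hc, hrep⟩ := exists_rep_mk (segre σ) hσ
    have := incentive_eq_zero_of_mem hmem i
    rw [hrep, incentive_smul] at this
    exact (mul_eq_zero.1 this).resolve_left hc
  · rintro ⟨hn, hD⟩
    exact ⟨hn.1, hn.2, segre_ne_zero hn, mk_segre_mem _ hD (hpos σ hn hD)⟩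

/-! ### Functions on the chart that are incentives. -/

/-- On the chart of normalized points, `Φ` is the incentive of the isolated player `i` for a
suitable payoff table. -/
def IsIncentive {a l : ℕ} (i : Fin a) (Φ : (SegreIndex a l → ℝ) → ℝ) : Prop :=
  ∃ D : Tensor (Player a l), ∀ σ, IsNormalized σ →
    ∑ j : Profile (Player a l) with j (Sum.inl i) = 1, D j * segre σ j = Φ σ

namespace IsIncentive

variable {a l : ℕ} {i : Fin a}

theorem add {Φ Ψ : (SegreIndex a l → ℝ) → ℝ} (hΦ : IsIncentive i Φ) (hΨ : IsIncentive i Ψ) :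
    IsIncentive i fun σ => Φ σ + Ψ σ := by
  obtain ⟨D, hD⟩ := hΦ
  obtain ⟨E, hE⟩ := hΨ
  refine ⟨D + E, fun σ hσ => ?_⟩
  simp [add_mul, Finset.sum_add_distrib, hD σ hσ, hE σ hσ]

theorem const_mul {Φ : (SegreIndex a l → ℝ) → ℝ} (hΦ : IsIncentive i Φ) (c : ℝ) :
    IsIncentive i fun σ => c * Φ σ := by
  obtain ⟨D, hD⟩ := hΦ
  refine ⟨c • D, fun σ hσ => ?_⟩
  simp [mul_assoc, ← Finset.mul_sum, hD σ hσ]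

theorem sub {Φ Ψ : (SegreIndex a l → ℝ) → ℝ} (hΦ : IsIncentive i Φ) (hΨ : IsIncentive i Ψ) :
    IsIncentive i fun σ => Φ σ - Ψ σ := by
  simpa [sub_eq_add_neg] using hΦ.add (hΨ.const_mul (-1))

theorem zero : IsIncentive (a := a) (l := l) i fun _ => 0 :=
  ⟨0, fun σ _ => by simp⟩

theorem sum {ι : Type*} (s : Finset ι) {Φ : ι → (SegreIndex a l → ℝ) → ℝ}
    (h : ∀ t ∈ s, IsIncentive i (Φ t)) : IsIncentive i fun σ => ∑ t ∈ s, Φ t σ := by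
  classical
  induction s using Finset.induction_on with
  | empty => simpa using zero
  | insert t s ht ih =>
    simp only [Finset.sum_insert ht]
    exact (h t (Finset.mem_insert_self t s)).add
      (ih fun u hu => h u (Finset.mem_insert_of_mem hu))

theorem segre_apply (j : Profile (Player a l)) (hj : j (Sum.inl i) = 1) :
    IsIncentive i fun σ => segre σ j := by
  refine ⟨Pi.single j 1, fun σ _ => ?_⟩
  rw [Finset.sum_eq_single_of_mem j (by simp [hj])]
  · simp
  · intro j' _ hne
    simp [hne]

theorem congr {Φ Ψ : (SegreIndex a l → ℝ) → ℝ} (hΦ : IsIncentive i Φ)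
    (h : ∀ σ, IsNormalized σ → Φ σ = Ψ σ) : IsIncentive i Ψ := by
  obtain ⟨D, hD⟩ := hΦ
  exact ⟨D, fun σ hσ => (hD σ hσ).trans (h σ hσ)⟩

/-- Take the profile in which exactly the players in `T` play the first strategy; all other factors
are normalized to `1`. Player `i` must play the second strategy, hence `i ∉ T`. -/
theorem prod_isolated (T : Finset (Fin a)) (hi : i ∉ T) :
    IsIncentive (l := l) i fun σ => ∏ t ∈ T, σ (Sum.inl (t, 0)) := by
  refine (segre_apply (Sum.elim (fun t => if t ∈ T then 0 else 1) fun _ => 1)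
    (by simp [hi])).congr fun σ hσ => ?_
  simp only [segre, Sum.elim_inl, Sum.elim_inr, hσ.2, Finset.prod_const_one, mul_one]
  rw [← Finset.prod_subset (Finset.subset_univ T)]
  · exact Finset.prod_congr rfl fun t ht => by simp [ht]
  · intro t _ ht
    simp [ht, hσ.1]

theorem isolated {t : Fin a} (h : t ≠ i) :
    IsIncentive (l := l) i fun σ => σ (Sum.inl (t, 0)) := by
  simpa using prod_isolated (l := l) {t} (by simpa using h.symm)

theorem pair (b : Fin l × Fin 2 × Fin 2) : IsIncentive i fun σ => σ (Sum.inr b) := by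
  obtain ⟨k, x, y⟩ := b
  refine (segre_apply (Sum.elim (fun _ => 1)
    fun q => if q.1 = k then (if q.2 = 0 then x else y) else 1) (by simp)).congr fun σ hσ => ?_
  simp only [segre, Sum.elim_inl, Sum.elim_inr, hσ.1, Finset.prod_const_one, one_mul]
  rw [Finset.prod_eq_single_of_mem k (Finset.mem_univ k)]
  · simp
  · intro k' _ hk
    simp [hk, hσ.2]

end IsIncentive

/-! ### Realizing a polynomial by copies of its variables. -/

/-- The factors of a monomial that is made multilinear by means of copies of its variables. -/
def monomialCopies {V : Type} [Fintype V] (n : ℕ) (m : V →₀ ℕ) :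
    Finset (V × Option (Fin n)) :=
  {t | ∃ c, t.2 = some c ∧ (c : ℕ) < m t.1}

theorem prod_monomialCopies {V : Type} [Fintype V] {n : ℕ} {m : V →₀ ℕ} (hm : ∀ v, m v ≤ n)
    (z : V → ℝ) : ∏ t ∈ monomialCopies n m, z t.1 = ∏ v, z v ^ m v := by
  classical
  rw [monomialCopies, Finset.prod_filter, Fintype.prod_prod_type]
  refine Finset.prod_congr rfl fun v _ => ?_
  rw [Fintype.prod_option]
  have h : (Finset.univ.filter fun c : Fin n => (c : ℕ) < m v).card = m v := by
    rw [Fin.card_filter_val_lt, min_eq_right (hm v)]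
  simp only [reduceCtorEq, false_and, exists_false, if_false, one_mul, Option.some.injEq,
    exists_eq_left']
  rw [← Finset.prod_filter, Finset.prod_const, h]

/-- The point of the chart given by the values `z`, all copies of a variable being equal. -/
def chartPoint {a l : ℕ} {U C : Type} (e : (U ⊕ Fin l × Fin 2 × Fin 2) × C ≃ Fin a)
    (z : U ⊕ Fin l × Fin 2 × Fin 2 → ℝ) : SegreIndex a l → ℝ :=
  Sum.elim (fun q => if q.2 = 0 then z (e.symm q.1).1 else 1) fun b => z (Sum.inr b)

/-- A polynomial all of whose real zeros have positive coordinates can be realized by a game. -/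
theorem exists_affinePart_iso_zeroSet {W : Type} [Fintype W] {l : ℕ}
    (G : MvPolynomial (Option W ⊕ Fin l × Fin 2 × Fin 2) ℝ)
    (hpos : ∀ z, MvPolynomial.eval z G = 0 → ∀ v, 0 < z v)
    (hone : ∀ z, MvPolynomial.eval z G = 0 → ∀ k, z (Sum.inr (k, 1, 1)) = 1) :
    ∃ (a : ℕ) (X : BinaryGame (Player a l)),
      AreIsomorphic (affinePart X) {z | MvPolynomial.eval z G = 0} := by
  classical
  set d := G.totalDegree with hd
  let V := Option W ⊕ Fin l × Fin 2 × Fin 2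
  let e : V × Option (Fin (d + 2)) ≃ Fin (Fintype.card (V × Option (Fin (d + 2)))) :=
    Fintype.equivFin _
  set a := Fintype.card (V × Option (Fin (d + 2)))
  let y : (SegreIndex a l → ℝ) → V × Option (Fin (d + 2)) → ℝ := fun σ t => σ (Sum.inl (e t, 0))
  -- No equation may involve its own player's coordinate. Hence player `(v, some c)` compares the
  -- cyclically next copy `c + 1`, different from `c` because `d + 2 ≥ 2`, with the copy `none`. The
  -- equation `G = 0` uses only `some` copies and is left to the `none` copy of the auxiliary
  -- variable.
  let E : V × Option (Fin (d + 2)) → (SegreIndex a l → ℝ) → ℝ := fun t σ =>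
    match t with
    | (v, some c) => y σ (v, some (c + 1)) - y σ (v, none)
    | (Sum.inl none, none) =>
      ∑ m ∈ G.support, G.coeff m * ∏ t ∈ monomialCopies (d + 2) m, y σ t
    | (Sum.inl (some _), none) => 0
    | (Sum.inr b, none) => σ (Sum.inr b) - y σ (Sum.inr b, some 0)
  have hE : ∀ t, IsIncentive (e t) (E t) := by
    rintro ⟨(_ | w) | b, _ | c⟩
    case inl.none.none =>
      refine IsIncentive.sum _ fun m _ => IsIncentive.const_mul ?_ _
      have := IsIncentive.prod_isolated (l := l) (i := e (Sum.inl none, none))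
        ((monomialCopies (d + 2) m).map e.toEmbedding) (by simp [monomialCopies])
      simp only [Finset.prod_map] at this
      exact this
    case inl.some.none => exact IsIncentive.zero
    case inr.none =>
      exact (IsIncentive.pair b).sub (IsIncentive.isolated fun h => by simpa using e.injective h)
    all_goals
      exact (IsIncentive.isolated fun h => by simpa using e.injective h).sub
        (IsIncentive.isolated fun h => by simpa using e.injective h)
  choose D hD using hE
  have hinc : ∀ σ, IsNormalized σ → ∀ i, incentive (fun i => D (e.symm i)) i (segre σ) =
      E (e.symm i) σ := by
    intro σ hσ i
    have := hD (e.symm i) σ hσ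
    rwa [e.apply_symm_apply] at this
  have hG : ∀ (σ : SegreIndex a l → ℝ) (z : V → ℝ), (∀ v c, y σ (v, some c) = z v) →
      E (Sum.inl none, none) σ = MvPolynomial.eval z G := by
    intro σ z hz
    rw [MvPolynomial.eval_eq']
    refine Finset.sum_congr rfl fun m hm => ?_
    -- Exponents are at most the total degree `d`, so there are enough copies.
    rw [← prod_monomialCopies (n := d + 2) fun v => ((Finsupp.le_degree v m).trans
      (MvPolynomial.le_totalDegree hm)).trans (Nat.le_add_right _ _)]
    congr 1
    refine Finset.prod_congr rfl fun t ht => ?_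
    obtain ⟨v, c⟩ := t
    obtain ⟨c', hc, -⟩ := (Finset.mem_filter.1 ht).2
    simp only at hc
    rw [hc, hz]
  have hsol : ∀ σ, IsNormalized σ → ((∀ i, incentive (fun i => D (e.symm i)) i (segre σ) = 0) ↔
      MvPolynomial.eval (fun v => y σ (v, none)) G = 0 ∧
        σ = chartPoint e fun v => y σ (v, none)) := by
    intro σ hσ
    have h1 : (∀ i, incentive (fun i => D (e.symm i)) i (segre σ) = 0) ↔ ∀ t, E t σ = 0 := by
      simp only [hinc σ hσ]
      exact e.symm.forall_congr_left (p := fun i => E (e.symm i) σ = 0) |>.trans (by simp)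
    rw [h1]
    constructor
    · intro h
      have hc : ∀ v c, y σ (v, some c) = y σ (v, none) := fun v c => by
        -- The equation for copy `c` belongs to its cyclic predecessor.
        have := h (v, some (c - 1))
        simp only [E, sub_add_cancel] at this
        linarith
      refine ⟨(hG σ _ hc).symm.trans (h (Sum.inl none, none)), ?_⟩
      funext s
      rcases s with ⟨i, c⟩ | b
      · obtain ⟨⟨v, o⟩, rfl⟩ := e.surjective i
        rcases Fin.exists_fin_two.1 ⟨c, rfl⟩ with rfl | rfl
        · cases o with
          | none => simp [chartPoint, y]
          | some o => simpa [chartPoint] using hc v o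
        · simp [chartPoint, hσ.1]
      · have := h (Sum.inr b, none)
        simp only [E, hc] at this
        simp only [chartPoint, Sum.elim_inr]
        linarith
    · rintro ⟨hz, hs⟩
      have hc : ∀ v c, y σ (v, some c) = y σ (v, none) := fun v c => by
        have := congrFun hs (Sum.inl (e (v, some c), 0))
        simpa [chartPoint] using this
      rintro ⟨(_ | w) | b, _ | c⟩
      case inl.none.none => rw [hG σ _ hc, hz]
      case inl.some.none => rfl
      case inr.none =>
        have := congrFun hs (Sum.inr b)
        simp only [chartPoint, Sum.elim_inr] at this
        simp only [E, hc]
        linarith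
      all_goals simp only [E, hc, sub_self]
  have hchart : ∀ z : V → ℝ, (∀ v, 0 < z v) → ∀ s, 0 < chartPoint e z s := by
    rintro z hz (⟨i, c⟩ | b)
    · simp only [chartPoint, Sum.elim_inl]
      split_ifs
      · exact hz _
      · exact one_pos
    · exact hz _
  have hmem := mem_affinePart_incentiveGame (D := fun i => D (e.symm i)) (l := l) fun σ hσ h => by
    obtain ⟨hz, hs⟩ := (hsol σ hσ).1 h
    rw [hs]
    exact hchart _ (hpos _ hz)
  let f : V → MvPolynomial (SegreIndex a l) ℝ := fun v => MvPolynomial.X (Sum.inl (e (v, none), 0))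
  let g : SegreIndex a l → MvPolynomial V ℝ :=
    Sum.elim (fun q => if q.2 = 0 then MvPolynomial.X (e.symm q.1).1 else 1)
      fun b => MvPolynomial.X (Sum.inr b)
  have hf : ∀ σ, polyMap f σ = fun v => y σ (v, none) := fun σ => by
    funext v
    simp [polyMap, f, y]
  have hg : ∀ z, polyMap g z = chartPoint e z := fun z => by
    funext s
    rcases s with ⟨i, c⟩ | b
    · simp only [polyMap, g, chartPoint, Sum.elim_inl]
      split_ifs <;> simp
    · simp [polyMap, g, chartPoint]
  have hyc : ∀ z : V → ℝ, (fun v => y (chartPoint e z) (v, none)) = z := fun z => by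
    funext v
    simp [y, chartPoint]
  refine ⟨a, incentiveGame fun i => D (e.symm i), f, g, ?_, ?_, ?_, ?_⟩
  · intro σ hσ
    rw [hmem] at hσ
    rw [hf]
    exact ((hsol σ hσ.1).1 hσ.2).1
  · intro z hz
    have hn : IsNormalized (chartPoint e z) :=
      ⟨fun i => by simp [chartPoint], fun k => by simpa [chartPoint] using hone z hz k⟩
    rw [hg, hmem]
    refine ⟨hn, (hsol _ hn).2 ?_⟩
    rw [hyc]
    exact ⟨hz, rfl⟩
  · intro σ hσ
    rw [hmem] at hσ
    rw [hf, hg]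
    exact ((hsol σ hσ.1).1 hσ.2).2.symm
  · intro z _
    rw [hf, hg, hyc]

/-! ### Encoding a real zero set by positive coordinates. -/

/-- The polynomial whose real zeros are the zeros `s` of `F`, with each coordinate encoded by the
positive numbers `s i ^ 2 + 1` and `(s i + 1) ^ 2 + 1`, and with all auxiliary coordinates equal to
`1`. -/
def positiveModel {μ β : Type} [Fintype μ] [Fintype β] (F : MvPolynomial μ ℝ) :
    MvPolynomial (Option (μ ⊕ μ) ⊕ β) ℝ :=
  let p i := MvPolynomial.X (Sum.inl (some (Sum.inl i)))
  let q i := MvPolynomial.X (Sum.inl (some (Sum.inr i)))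
  -- With `p = s ^ 2 + 1` and `q = (s + 1) ^ 2 + 1`, the difference `q - p - 1` is `2 * s`; the
  -- second sum expresses `p - 1 = s ^ 2`.
  (MvPolynomial.bind₁ (fun i => MvPolynomial.C (1 / 2) * (q i - p i - 1)) F) ^ 2 +
    ∑ i, (4 * (p i - 1) - (q i - p i - 1) ^ 2) ^ 2 + (MvPolynomial.X (Sum.inl none) - 1) ^ 2 +
    ∑ b, (MvPolynomial.X (Sum.inr b) - 1) ^ 2

theorem eval_positiveModel {μ β : Type} [Fintype μ] [Fintype β] (F : MvPolynomial μ ℝ)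
    (z : Option (μ ⊕ μ) ⊕ β → ℝ) :
    MvPolynomial.eval z (positiveModel F) = 0 ↔
      MvPolynomial.eval (fun i => 1 / 2 *
        (z (Sum.inl (some (Sum.inr i))) - z (Sum.inl (some (Sum.inl i))) - 1)) F = 0 ∧
      (∀ i, 4 * (z (Sum.inl (some (Sum.inl i))) - 1) =
        (z (Sum.inl (some (Sum.inr i))) - z (Sum.inl (some (Sum.inl i))) - 1) ^ 2) ∧
      z (Sum.inl none) = 1 ∧ ∀ b, z (Sum.inr b) = 1 := by
  have hF := congrFun (polyMap_bind₁ (fun i => MvPolynomial.C (1 / 2) *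
    ((MvPolynomial.X (Sum.inl (some (Sum.inr i))) : MvPolynomial (Option (μ ⊕ μ) ⊕ β) ℝ) -
      MvPolynomial.X (Sum.inl (some (Sum.inl i))) - 1)) (fun _ : Unit => F) z) ()
  simp only [polyMap] at hF
  have hpoint : polyMap (fun i => MvPolynomial.C (1 / 2) *
    ((MvPolynomial.X (Sum.inl (some (Sum.inr i))) : MvPolynomial (Option (μ ⊕ μ) ⊕ β) ℝ) -
      MvPolynomial.X (Sum.inl (some (Sum.inl i))) - 1)) z = fun i => 1 / 2 *
        (z (Sum.inl (some (Sum.inr i))) - z (Sum.inl (some (Sum.inl i))) - 1) := by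
    funext i
    simp [polyMap]
  rw [hpoint] at hF
  simp only [positiveModel, map_add, map_pow, map_sum, hF]
  have hs : ∀ {ι : Type} [Fintype ι] (u : ι → ℝ), 0 ≤ ∑ i, u i ^ 2 := fun u =>
    Finset.sum_nonneg fun _ _ => sq_nonneg _
  have hs0 : ∀ {ι : Type} [Fintype ι] (u : ι → ℝ), ∑ i, u i ^ 2 = 0 ↔ ∀ i, u i = 0 := fun u => by
    simp [Finset.sum_eq_zero_iff_of_nonneg, sq_nonneg]
  rw [add_eq_zero_iff_of_nonneg (add_nonneg (add_nonneg (sq_nonneg _) (hs _)) (sq_nonneg _)) (hs _),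
    add_eq_zero_iff_of_nonneg (add_nonneg (sq_nonneg _) (hs _)) (sq_nonneg _),
    add_eq_zero_iff_of_nonneg (sq_nonneg _) (hs _), hs0, hs0]
  simp [sub_eq_zero, and_assoc]

theorem zeroSet_positiveModel_iso {μ β : Type} [Fintype μ] [Fintype β] (F : MvPolynomial μ ℝ) :
    AreIsomorphic {z | MvPolynomial.eval z (positiveModel (β := β) F) = 0}
      {s | MvPolynomial.eval s F = 0} := by
  let f : μ → MvPolynomial (Option (μ ⊕ μ) ⊕ β) ℝ := fun i => MvPolynomial.C (1 / 2) *
    (MvPolynomial.X (Sum.inl (some (Sum.inr i))) - MvPolynomial.X (Sum.inl (some (Sum.inl i))) - 1)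
  let g : Option (μ ⊕ μ) ⊕ β → MvPolynomial μ ℝ := Sum.elim
    (fun o => o.elim 1 (Sum.elim (fun i => MvPolynomial.X i ^ 2 + 1)
      fun i => (MvPolynomial.X i + 1) ^ 2 + 1)) fun _ => 1
  have hf : ∀ z, polyMap f z = fun i => 1 / 2 *
      (z (Sum.inl (some (Sum.inr i))) - z (Sum.inl (some (Sum.inl i))) - 1) := fun z => by
    funext i
    simp [polyMap, f]
  have hfg : ∀ s, polyMap f (polyMap g s) = s := fun s => by
    funext i
    rw [hf]
    simp only [polyMap, g, Sum.elim_inl, Sum.elim_inr, Option.elim, map_add, map_pow, map_one,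
      MvPolynomial.eval_X]
    ring
  refine ⟨f, g, ?_, ?_, ?_, fun s _ => hfg s⟩
  · intro z hz
    rw [hf]
    exact ((eval_positiveModel F z).1 hz).1
  · intro s hs
    refine (eval_positiveModel F _).2 ⟨?_, ?_, ?_, ?_⟩
    · rw [← hf, hfg]
      exact hs
    · intro i
      simp only [polyMap, g, Sum.elim_inl, Sum.elim_inr, Option.elim, map_add, map_pow, map_one,
        MvPolynomial.eval_X]
      ring
    · simp [polyMap, g]
    · simp [polyMap, g]
  · intro z hz
    obtain ⟨-, h₁, h₂, h₃⟩ := (eval_positiveModel F z).1 hz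
    funext v
    rcases v with (_ | i | i) | b
    · simp [polyMap, g, h₂]
    · rw [hf]
      simp only [polyMap, g, Sum.elim_inl, Option.elim, map_add, map_pow, map_one,
        MvPolynomial.eval_X]
      linear_combination (-1 / 4) * h₁ i
    · rw [hf]
      simp only [polyMap, g, Sum.elim_inl, Sum.elim_inr, Option.elim, map_add, map_pow, map_one,
        MvPolynomial.eval_X]
      linear_combination (-1 / 4) * h₁ i
    · simp [polyMap, g, h₃]

theorem pos_of_eval_positiveModel {μ β : Type} [Fintype μ] [Fintype β] {F : MvPolynomial μ ℝ}
    {z : Option (μ ⊕ μ) ⊕ β → ℝ} (hz : MvPolynomial.eval z (positiveModel F) = 0)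
    (v : Option (μ ⊕ μ) ⊕ β) : 0 < z v := by
  obtain ⟨-, h₁, h₂, h₃⟩ := (eval_positiveModel F z).1 hz
  rcases v with (_ | i | i) | b
  · simp [h₂]
  · nlinarith [h₁ i, sq_nonneg (z (Sum.inl (some (Sum.inr i))) -
      z (Sum.inl (some (Sum.inl i))) - 1)]
  -- The relation is equivalent to `4 * (q - 1) = (q - p + 1) ^ 2`, which gives `q ≥ 1`.
  · nlinarith [h₁ i, sq_nonneg (z (Sum.inl (some (Sum.inr i))) -
      z (Sum.inl (some (Sum.inl i))) + 1)]
  · simp [h₃]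

end NashCI
end

theorem theorem5p3 (l m : ℕ) (S : Set (Fin m → ℝ)) (hS : NashCI.IsRealAffineVariety S) :
    ∃ n a : ℕ, l ≤ n ∧ n = a + 2 * l ∧ ∃ X : NashCI.BinaryGame (NashCI.Player a l),
      NashCI.AreIsomorphic (NashCI.affinePart X) (NashCI.prodAffineSpace S l) := by
  obtain ⟨F, rfl⟩ := hS.exists_eq_zeroSet
  -- The `l` affine directions are variables that do not occur in `F`; they too are carried by
  -- isolated players.
  have hprod : NashCI.prodAffineSpace {x : Fin m → ℝ | MvPolynomial.eval x F = 0} l =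
      {z | MvPolynomial.eval z (MvPolynomial.rename (Sum.inl : Fin m → Fin m ⊕ Fin l) F) = 0} := by
    ext z
    simp only [NashCI.prodAffineSpace, Set.mem_ofPred_eq, MvPolynomial.eval_rename]
    rfl
  obtain ⟨a, X, hX⟩ := NashCI.exists_affinePart_iso_zeroSet (l := l)
    (NashCI.positiveModel (MvPolynomial.rename (Sum.inl : Fin m → Fin m ⊕ Fin l) F))
    (fun _ hz => NashCI.pos_of_eval_positiveModel hz)
    (fun z hz k => ((NashCI.eval_positiveModel _ z).1 hz).2.2.2 _)
  refine ⟨a + 2 * l, a, by lia, rfl, X, ?_⟩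
  rw [hprod]
  exact hX.trans (NashCI.zeroSet_positiveModel_iso _)
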